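/- Let $\mathcal{C}$ be a finitely complete category with a zero object $0$ in which every normal monomorphism (i.e. every kernel) has a cokernel. Terminology. A factorization system $(\mathcal{E},\mathcal{M})$ is a pair of classes of morphisms such that every morphism factors as $m e$ with $e\in\mathcal{E}$, $m\in\mathcal{M}$, and $\mathcal{E}={}^{\perp}\mathcal{M}$, $\mathcal{M}=\mathcal{E}^{\perp}$ (unique diagonals). It is reflective if $gf,g\in\mathcal{E}$ imply $f\in\mathcal{E}$, coreflective if $gf,f\in\mathcal{M}$ imply $g\in\mathcal{M}$, and a torsion theory if it is both. Put $\mathcal{F}(\mathcal{M})=\{B \mid (B\to 0)\in\mathcal{M}\}$ and $\mathcal{T}(\mathcal{E})=\{A\mid (0\to A)\in\mathcal{E}\}$; these are full subcategories, reflective and coreflective respectively. For a reflective full subcategory $\mathcal{F}$ with reflector $R$ and reflection $\rho:1\to R$, let $R^{-1}(\mathrm{Iso})$ be the class of morphisms $f$ with $Rf$ an isomorphism, and $\mathrm{Cart}(R,\rho)$ the class of morphisms whose $\rho$-naturality square is a pullback. A reflective factorization system is simple if $\mathcal{M}=\mathrm{Cart}(R,\rho)$ for $\mathcal{F}=\mathcal{F}(\mathcal{M})$.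 A torsion theory is normal if for every object $C$, with $\rho_C$ its reflection into $\mathcal{F}(\mathcal{M})$ and $\sigma_C$ its coreflection from $\mathcal{T}(\mathcal{E})$, the kernel $\kappa_C$ of $\rho_C$ and the cokernel $\pi_C$ of $\sigma_C$ exist and $\pi_C\kappa_C=0$. A subcategory is normal-epireflective (normal-monocoreflective) if it is reflective (coreflective) with reflections that are normal epimorphisms, i.e. cokernels (coreflections that are normal monomorphisms). A standard torsion theory is a pair $(\mathcal{T},\mathcal{F})$ of full replete subcategories such that every morphism from an object of $\mathcal{T}$ to an object of $\mathcal{F}$ is zero, and every object $C$ admits $A\xrightarrow{k}C\xrightarrow{q}B$ with $A\in\mathcal{T}$, $B\in\mathcal{F}$, $k=\ker q$, $q=\operatorname{coker}k$. A category with zero object is homological if it is regular (finite limits, coequalizers of kernel pairs, pullback-stable regular epimorphisms) and protomodular; for a regular category the latter means: given two adjacent commutative squares whose common vertical arrow is a regular epimorphism, if the left square and the outer rectangle are pullbacks, so is the right square. Theorem. 1. Suppose that normal epimorphisms are stable under pullback in $\mathcal{C}$. Then every standard torsion theory $(\mathcal{T},\mathcal{F})$ of $\mathcal{C}$ determines a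 simple reflective factorization system $(\mathcal{E},\mathcal{M})=(R^{-1}(\mathrm{Iso}),\mathrm{Cart}(R,\rho))$, where $\rho:1\to R$ is the reflection onto $\mathcal{F}$. It satisfies $\mathcal{F}(\mathcal{M})=\mathcal{F}$ and $\mathcal{T}(\mathcal{E})=\mathcal{T}$; moreover $\mathcal{F}(\mathcal{M})$ is normal-epireflective and $\mathcal{T}(\mathcal{E})$ is normal-monocoreflective. 2. If $\mathcal{C}$ is homological, then every simple reflective factorization system $(\mathcal{E},\mathcal{M})$ of $\mathcal{C}$ with $\mathcal{F}(\mathcal{M})$ normal-epireflective and $\mathcal{T}(\mathcal{E})$ normal-monocoreflective is a normal torsion theory. 3. If both $\mathcal{C}$ and $\mathcal{C}^{\mathrm{op}}$ are homological, then $(\mathcal{E},\mathcal{M})\mapsto(\mathcal{T}(\mathcal{E}),\mathcal{F}(\mathcal{M}))$ is a bijection from the normal torsion theories of $\mathcal{C}$ onto the standard torsion theories of $\mathcal{C}$, with inverse $(\mathcal{T},\mathcal{F})\mapsto(R^{-1}(\mathrm{Iso}),\mathrm{Cart}(R,\rho))$. -/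

import Mathlib

open CategoryTheory CategoryTheory.Limits ZeroObject

universe v u

namespace TorsionFactorization

section General

variable {C : Type u} [Category.{v} C]

/-- `e ⊥ m`: every commutative square from `e` to `m` has a unique diagonal. -/
def Orth {A B X Y : C} (e : A ⟶ B) (m : X ⟶ Y) : Prop :=
  ∀ (a : A ⟶ X) (b : B ⟶ Y), a ≫ m = e ≫ b → ∃! d : B ⟶ X, e ≫ d = a ∧ d ≫ m = b

/-- The class of all morphisms `m` with `e ⊥ m` for every `e` in `E`. -/
def rightOrth (E : MorphismProperty C) : MorphismProperty C :=
  fun _ _ m => ∀ ⦃A B : C⦄ (e : A ⟶ B), E e → Orth e m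

/-- The class of all morphisms `e` with `e ⊥ m` for every `m` in `M`. -/
def leftOrth (M : MorphismProperty C) : MorphismProperty C :=
  fun _ _ e => ∀ ⦃X Y : C⦄ (m : X ⟶ Y), M m → Orth e m

/-- An (orthogonal) factorization system. -/
structure IsFactorizationSystem (E M : MorphismProperty C) : Prop where
  factors : ∀ ⦃A B : C⦄ (f : A ⟶ B), ∃ (Z : C) (e : A ⟶ Z) (m : Z ⟶ B), E e ∧ M m ∧ e ≫ m = f
  left_eq : E = leftOrth M
  right_eq : M = rightOrth E

/-- A factorization system is reflective if `gf ∈ E` and `g ∈ E` imply `f ∈ E`. -/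
structure IsReflectiveFS (E M : MorphismProperty C) : Prop extends IsFactorizationSystem E M where
  cancel_left : ∀ ⦃X Y Z : C⦄ (f : X ⟶ Y) (g : Y ⟶ Z), E (f ≫ g) → E g → E f

/-- A factorization system is coreflective if `gf ∈ M` and `f ∈ M` imply `g ∈ M`. -/
structure IsCoreflectiveFS (E M : MorphismProperty C) : Prop
    extends IsFactorizationSystem E M where
  cancel_right : ∀ ⦃X Y Z : C⦄ (f : X ⟶ Y) (g : Y ⟶ Z), M (f ≫ g) → M f → M g

/-- A torsion theory is a factorization system that is both reflective and coreflective. -/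
structure IsTorsionTheory (E M : MorphismProperty C) : Prop where
  reflective : IsReflectiveFS E M
  coreflective : IsCoreflectiveFS E M

/-- `ρ : A ⟶ A'` is a reflection of `A` into the full subcategory `F`: `A'` lies in `F` and every
morphism from `A` to an object of `F` factors uniquely through `ρ`. -/
def IsReflection (F : ObjectProperty C) {A A' : C} (ρ : A ⟶ A') : Prop :=
  F A' ∧ ∀ ⦃X : C⦄, F X → ∀ g : A ⟶ X, ∃! h : A' ⟶ X, ρ ≫ h = g

/-- `σ : A' ⟶ A` is a coreflection of `A` into the full subcategory `T`. -/
def IsCoreflection (T : ObjectProperty C) {A' A : C} (σ : A' ⟶ A) : Prop :=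
  T A' ∧ ∀ ⦃X : C⦄, T X → ∀ g : X ⟶ A, ∃! h : X ⟶ A', h ≫ σ = g

/-- `R⁻¹(Iso C)` for a reflective full subcategory `F` with reflector `R`. In the naturality square
below, `g` is the value `R f` of the reflector, computed with the reflections `ρA`, `ρB`; the
condition does not depend on the choice of these. -/
def invertedByReflector (F : ObjectProperty C) : MorphismProperty C :=
  fun A B f => ∀ ⦃A' B' : C⦄ (ρA : A ⟶ A') (ρB : B ⟶ B') (g : A' ⟶ B'),
    IsReflection F ρA → IsReflection F ρB → ρA ≫ g = f ≫ ρB → IsIso g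

/-- `Cart(R, ρ)` for a reflective full subcategory `F` with reflector `R` and reflection `ρ`:
the morphisms whose `ρ`-naturality square is a pullback. -/
def cartesianForReflector (F : ObjectProperty C) : MorphismProperty C :=
  fun A B f => ∀ ⦃A' B' : C⦄ (ρA : A ⟶ A') (ρB : B ⟶ B') (g : A' ⟶ B'),
    IsReflection F ρA → IsReflection F ρB → ρA ≫ g = f ≫ ρB → IsPullback ρA f g ρB

end General

section Pointed

variable {C : Type u} [Category.{v} C] [HasZeroMorphisms C]

/-- The class of normal epimorphisms, i.e. of the morphisms that occur as cokernels. -/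
def normalEpis (C : Type u) [Category.{v} C] [HasZeroMorphisms C] : MorphismProperty C :=
  fun _ _ f => Nonempty (NormalEpi f)

/-- The class of normal monomorphisms, i.e. of the morphisms that occur as kernels. -/
def normalMonos (C : Type u) [Category.{v} C] [HasZeroMorphisms C] : MorphismProperty C :=
  fun _ _ f => Nonempty (NormalMono f)

/-- `k` is a kernel of `q`. -/
def IsKernelOf {A B D : C} (k : A ⟶ B) (q : B ⟶ D) : Prop :=
  ∃ w : k ≫ q = 0, Nonempty (IsLimit (KernelFork.ofι k w))

/-- `q` is a cokernel of `k`. -/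
def IsCokernelOf {A B D : C} (k : A ⟶ B) (q : B ⟶ D) : Prop :=
  ∃ w : k ≫ q = 0, Nonempty (IsColimit (CokernelCofork.ofπ q w))

/-- `F` is reflective with normal epimorphisms as reflections. -/
def IsNormalEpireflective (F : ObjectProperty C) : Prop :=
  ∀ A : C, ∃ (A' : C) (ρ : A ⟶ A'), IsReflection F ρ ∧ normalEpis C ρ

/-- `T` is coreflective with normal monomorphisms as coreflections. -/
def IsNormalMonocoreflective (T : ObjectProperty C) : Prop :=
  ∀ A : C, ∃ (A' : C) (σ : A' ⟶ A), IsCoreflection T σ ∧ normalMonos C σ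

/-- A standard torsion theory: a pair of full replete subcategories `T`, `F` with only zero
morphisms from `T` to `F`, such that every object is the middle of a short exact sequence with
outer terms in `T` and `F`. -/
structure IsStandardTorsionTheory (T F : ObjectProperty C) : Prop where
  replete_torsion : T.IsClosedUnderIsomorphisms
  replete_torsionFree : F.IsClosedUnderIsomorphisms
  hom_eq_zero : ∀ ⦃A B : C⦄, T A → F B → ∀ f : A ⟶ B, f = 0
  exists_sequence : ∀ X : C, ∃ (A B : C) (k : A ⟶ X) (q : X ⟶ B),
    T A ∧ F B ∧ IsKernelOf k q ∧ IsCokernelOf k q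

/-- A homological category (the category being pointed by the ambient instances): regular (which
includes finite limits) and protomodular. In a regular category the latter means that whenever, in
a diagram
```
  A₁ --h₁--> A₂ --h₂--> A₃
  |a         |p         |c
  B₁ --k₁--> B₂ --k₂--> B₃
```
with `p` a regular epimorphism, the left-hand square and the outer rectangle are pullbacks, then so
is the right-hand square. -/
structure IsHomological (C : Type u) [Category.{v} C] [HasZeroObject C] [HasZeroMorphisms C] :
    Prop where
  regular : Regular C
  protomodular : ∀ ⦃A₁ A₂ A₃ B₁ B₂ B₃ : C⦄ (h₁ : A₁ ⟶ A₂) (h₂ : A₂ ⟶ A₃) (k₁ : B₁ ⟶ B₂)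
    (k₂ : B₂ ⟶ B₃) (a : A₁ ⟶ B₁) (p : A₂ ⟶ B₂) (c : A₃ ⟶ B₃), IsRegularEpi p →
    h₂ ≫ c = p ≫ k₂ → IsPullback h₁ a p k₁ → IsPullback (h₁ ≫ h₂) a c (k₁ ≫ k₂) →
    IsPullback h₂ p c k₂

variable [HasZeroObject C]

/-- `F(M)`: the objects `B` with `(B ⟶ 0) ∈ M`. -/
noncomputable def torsionFreePart (M : MorphismProperty C) : ObjectProperty C :=
  fun B => M (0 : B ⟶ (0 : C))

/-- `T(E)`: the objects `A` with `(0 ⟶ A) ∈ E`. -/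
noncomputable def torsionPart (E : MorphismProperty C) : ObjectProperty C :=
  fun A => E (0 : (0 : C) ⟶ A)

/-- A reflective factorization system is simple if `M = Cart(R, ρ)`, with `ρ : 1 ⟶ R` the
reflection onto `F(M)`. -/
structure IsSimpleReflectiveFS (E M : MorphismProperty C) : Prop extends IsReflectiveFS E M where
  eq_cartesian : M = cartesianForReflector (torsionFreePart M)

/-- A torsion theory is normal if, for every object `X`, the kernel `κ` of the reflection `ρ` of
`X` into `F(M)` followed by the cokernel `π` of the coreflection `σ` of `X` into `T(E)` is zero. -/
structure IsNormalTorsionTheory (E M : MorphismProperty C) : Prop extends IsTorsionTheory E M where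
  kernel_comp_cokernel : ∀ X : C, ∃ (SX RX KX QX : C) (σ : SX ⟶ X) (ρ : X ⟶ RX) (κ : KX ⟶ X)
    (π : X ⟶ QX), IsCoreflection (torsionPart E) σ ∧ IsReflection (torsionFreePart M) ρ ∧
      IsKernelOf κ ρ ∧ IsCokernelOf σ π ∧ κ ≫ π = 0

end Pointed

end TorsionFactorization

/-!
Write `F` and `T` for the torsion-free and the torsion part, and `ρ` for reflections onto `F`.

From a standard torsion theory: the cokernel `X ⟶ B` in a short exact sequence is a reflection onto
`F`, and conversely a normal epimorphism onto an object of `F` with kernel in `T` is a reflection.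
The second description passes to pullbacks when normal epimorphisms do, so the comparison of
`f : A ⟶ B` with the pullback of `ρ_B` along `R f` factors `f` through `R⁻¹(Iso)` and `Cart(R, ρ)`
(`IsStandardTorsionTheory.exists_factorization`). Orthogonality is formal.

From a simple reflective factorization system in a homological category: if `f` and `f ≫ g` are
cartesian, protomodularity for the two naturality squares, glued along a reflection that is a
regular epimorphism, makes `g` cartesian (`IsSimpleReflectiveFS.isCoreflectiveFS`). The kernel `κ`
of a reflection is in `M`, and its naturality square being a pullback forces the domain of `κ` to
be torsion (`IsSimpleReflectiveFS.torsionPart_of_isKernelOf`). So `κ` factors through the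
coreflection, which gives normality.

For the bijection: in a torsion theory `F` is closed under subobjects and `T` under quotients. When
both `C` and `Cᵒᵖ` are homological, image factorizations then show that reflections are normal
epimorphisms and coreflections are normal monomorphisms
(`IsTorsionTheory.normalEpi_of_isReflection`, `IsTorsionTheory.normalMono_of_isCoreflection`), and
normality identifies the coreflection with the kernel of the reflection. The construction of a
standard torsion theory is inverse to that of a normal one, because a reflective factorization
system has `E = R⁻¹(Iso)` (`IsReflectiveFS.left_eq_invertedByReflector`), and `E` determines `M`.
The facts on homological categories that are needed are that regular epimorphisms are normal
(`IsHomological.normalEpi_of_isRegularEpi`) and hence that normal epimorphisms are stable under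
pullback.
-/

namespace TorsionFactorization

section General

variable {C : Type u} [Category.{v} C]

/-! ### Orthogonality and factorization systems -/

lemma leftOrth_of_isIso (M : MorphismProperty C) {A B : C} (e : A ⟶ B) [IsIso e] :
    leftOrth M e := fun X Y m _ a b w =>
  ⟨inv e ≫ a, by simp [w], fun d hd => by simp [← hd.1]⟩

lemma rightOrth_of_isIso (E : MorphismProperty C) {X Y : C} (m : X ⟶ Y) [IsIso m] :
    rightOrth E m := fun A B e _ a b w =>
  ⟨b ≫ inv m, by simp [← reassoc_of% w], fun d hd => by simp [← hd.2]⟩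

lemma leftOrth_comp {M : MorphismProperty C} {A B D : C} {e : A ⟶ B} {f : B ⟶ D}
    (he : leftOrth M e) (hf : leftOrth M f) : leftOrth M (e ≫ f) := by
  intro X Y m hm a b w
  obtain ⟨d, ⟨hd₁, hd₂⟩, hd⟩ := he m hm a (f ≫ b) (by simpa using w)
  obtain ⟨d', ⟨hd'₁, hd'₂⟩, hd'⟩ := hf m hm d b hd₂
  refine ⟨d', ⟨by simp [hd'₁, hd₁], hd'₂⟩, ?_⟩
  rintro d'' ⟨h₁, h₂⟩
  exact hd' d'' ⟨hd (f ≫ d'') ⟨by simpa using h₁, by simp [h₂]⟩, h₂⟩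

lemma leftOrth_of_comp {M : MorphismProperty C} {A B D : C} {e : A ⟶ B} {f : B ⟶ D}
    (hef : leftOrth M (e ≫ f)) (he : leftOrth M e) : leftOrth M f := by
  intro X Y m hm a b w
  obtain ⟨d, ⟨hd₁, hd₂⟩, hd⟩ := hef m hm (e ≫ a) b (by simp [w])
  refine ⟨d, ⟨?_, hd₂⟩, fun d' h' => hd d' ⟨by simp [h'.1], h'.2⟩⟩
  exact (he m hm (e ≫ a) (f ≫ b) (by simp [w])).unique ⟨by simpa using hd₁, by simp [hd₂]⟩
    ⟨rfl, w⟩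

lemma rightOrth_of_comp {E : MorphismProperty C} {X Y Z : C} {f : X ⟶ Y} {g : Y ⟶ Z}
    (hfg : rightOrth E (f ≫ g)) (hg : rightOrth E g) : rightOrth E f := by
  intro A B e he a b w
  obtain ⟨d, ⟨hd₁, hd₂⟩, hd⟩ := hfg e he a (b ≫ g) (by simp [reassoc_of% w])
  refine ⟨d, ⟨hd₁, ?_⟩, fun d' h' => hd d' ⟨h'.1, by simp [← h'.2]⟩⟩
  exact (hg e he (a ≫ f) (b ≫ g) (by simp [reassoc_of% w])).unique
    ⟨by simp [reassoc_of% hd₁], by simpa using hd₂⟩ ⟨w.symm, rfl⟩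

lemma rightOrth_of_isPullback {E : MorphismProperty C} {P X Y Z : C} {m' : P ⟶ X} {t : P ⟶ Y}
    {s : X ⟶ Z} {m : Y ⟶ Z} (h : IsPullback m' t s m) (hm : rightOrth E m) :
    rightOrth E m' := by
  intro A B e he a b w
  obtain ⟨d, ⟨hd₁, hd₂⟩, hd⟩ := hm e he (a ≫ t) (b ≫ s) (by simp [← h.w, reassoc_of% w])
  refine ⟨h.lift b d hd₂.symm, ⟨h.hom_ext (by simp [w]) (by simp [hd₁]), by simp⟩, ?_⟩
  rintro d' ⟨h₁, h₂⟩
  refine h.hom_ext (by simp [h₂]) ?_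
  rw [h.lift_snd]
  exact hd _ ⟨by simp [reassoc_of% h₁], by simp [← h.w, reassoc_of% h₂]⟩

/-- Orthogonality together with the existence of factorizations makes each class the full
orthogonal of the other, provided both are closed under composition with isomorphisms. -/
lemma IsFactorizationSystem.of_orth {E M : MorphismProperty C}
    (factors : ∀ ⦃A B : C⦄ (f : A ⟶ B), ∃ (Z : C) (e : A ⟶ Z) (m : Z ⟶ B),
      E e ∧ M m ∧ e ≫ m = f)
    (orth : ∀ ⦃A B X Y : C⦄ (e : A ⟶ B) (m : X ⟶ Y), E e → M m → Orth e m)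
    (E_comp : ∀ ⦃A B D : C⦄ (e : A ⟶ B) (i : B ⟶ D), IsIso i → E e → E (e ≫ i))
    (M_comp : ∀ ⦃A B D : C⦄ (i : A ⟶ B) (m : B ⟶ D), IsIso i → M m → M (i ≫ m)) :
    IsFactorizationSystem E M where
  factors := factors
  left_eq := by
    funext A B f
    refine propext ⟨fun hf X Y m hm => orth f m hf hm, fun hf => ?_⟩
    obtain ⟨Z, e, m, he, hm, rfl⟩ := factors f
    obtain ⟨d, ⟨hd₁, hd₂⟩, -⟩ := hf m hm e (𝟙 _) (by simp)
    have : m ≫ d = 𝟙 Z := (orth e m he hm e m rfl).unique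
      ⟨by simpa using hd₁, by simp [hd₂]⟩ ⟨by simp, by simp⟩
    exact E_comp e m ⟨d, this, hd₂⟩ he
  right_eq := by
    funext A B f
    refine propext ⟨fun hf X Y e he => orth e f he hf, fun hf => ?_⟩
    obtain ⟨Z, e, m, he, hm, rfl⟩ := factors f
    obtain ⟨d, ⟨hd₁, hd₂⟩, -⟩ := hf e he (𝟙 _) m (by simp)
    have : d ≫ e = 𝟙 Z := (orth e m he hm e m rfl).unique
      ⟨by simp [reassoc_of% hd₁], by simpa using hd₂⟩ ⟨by simp, by simp⟩
    exact M_comp e m ⟨d, hd₁, this⟩ hm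

namespace IsFactorizationSystem

variable {E M : MorphismProperty C} (h : IsFactorizationSystem E M)
include h

lemma orth {A B X Y : C} {e : A ⟶ B} {m : X ⟶ Y} (he : E e) (hm : M m) : Orth e m := by
  rw [h.left_eq] at he
  exact he m hm

lemma left_of_isIso {A B : C} (e : A ⟶ B) [IsIso e] : E e := by
  rw [h.left_eq]; exact leftOrth_of_isIso M e

lemma right_of_isIso {A B : C} (m : A ⟶ B) [IsIso m] : M m := by
  rw [h.right_eq]; exact rightOrth_of_isIso E m

lemma left_comp {X Y Z : C} {f : X ⟶ Y} {g : Y ⟶ Z} (hf : E f) (hg : E g) : E (f ≫ g) := by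
  rw [h.left_eq] at *; exact leftOrth_comp hf hg

lemma left_of_comp {X Y Z : C} {f : X ⟶ Y} {g : Y ⟶ Z} (hfg : E (f ≫ g)) (hf : E f) : E g := by
  rw [h.left_eq] at *; exact leftOrth_of_comp hfg hf

lemma right_of_comp {X Y Z : C} {f : X ⟶ Y} {g : Y ⟶ Z} (hfg : M (f ≫ g)) (hg : M g) : M f := by
  rw [h.right_eq] at *; exact rightOrth_of_comp hfg hg

lemma right_of_isPullback {P X Y Z : C} {m' : P ⟶ X} {t : P ⟶ Y} {s : X ⟶ Z} {m : Y ⟶ Z}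
    (sq : IsPullback m' t s m) (hm : M m) : M m' := by
  rw [h.right_eq] at *; exact rightOrth_of_isPullback sq hm

lemma isIso_of_left_of_right {X Y : C} {f : X ⟶ Y} (hE : E f) (hM : M f) : IsIso f := by
  obtain ⟨d, ⟨hd₁, hd₂⟩, -⟩ := h.orth hE hM (𝟙 _) (𝟙 _) (by simp)
  exact ⟨d, hd₁, hd₂⟩

end IsFactorizationSystem

/-! ### Reflections and coreflections -/

namespace IsReflection

variable {F : ObjectProperty C} {A A' : C} {ρ : A ⟶ A'} (h : IsReflection F ρ)
include h

lemma exists_desc {X : C} (hX : F X) (g : A ⟶ X) : ∃ t : A' ⟶ X, ρ ≫ t = g :=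
  (h.2 hX g).exists

lemma hom_ext {X : C} (hX : F X) {s t : A' ⟶ X} (hst : ρ ≫ s = ρ ≫ t) : s = t :=
  (h.2 hX (ρ ≫ t)).unique hst rfl

lemma exists_iso {A'' : C} {ρ' : A ⟶ A''} (h' : IsReflection F ρ') :
    ∃ i : A' ≅ A'', ρ ≫ i.hom = ρ' := by
  obtain ⟨s, hs⟩ := h.exists_desc h'.1 ρ'
  obtain ⟨t, ht⟩ := h'.exists_desc h.1 ρ
  exact ⟨⟨s, t, h.hom_ext h.1 (by simp [reassoc_of% hs, ht]),
    h'.hom_ext h'.1 (by simp [reassoc_of% ht, hs])⟩, hs⟩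

/-- Membership in `R⁻¹(Iso)` can be tested on one naturality square. -/
lemma invertedByReflector_iff {B B' : C} {ρB : B ⟶ B'} (hB : IsReflection F ρB) {f : A ⟶ B}
    {g : A' ⟶ B'} (w : ρ ≫ g = f ≫ ρB) : invertedByReflector F f ↔ IsIso g := by
  refine ⟨fun hf => hf ρ ρB g h hB w, fun hg A'' B'' ρ' ρB' g' h' hB' w' => ?_⟩
  obtain ⟨i, hi⟩ := h'.exists_iso h
  obtain ⟨j, hj⟩ := hB.exists_iso hB'
  obtain rfl : i.hom ≫ g ≫ j.hom = g' :=
    h'.hom_ext hB'.1 (by simp [reassoc_of% hi, reassoc_of% w, hj, w'])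
  infer_instance

/-- Membership in `Cart(R, ρ)` can be tested on one naturality square. -/
lemma cartesianForReflector_iff {B B' : C} {ρB : B ⟶ B'} (hB : IsReflection F ρB) {f : A ⟶ B}
    {g : A' ⟶ B'} (w : ρ ≫ g = f ≫ ρB) :
    cartesianForReflector F f ↔ IsPullback ρ f g ρB := by
  refine ⟨fun hf => hf ρ ρB g h hB w, fun hg A'' B'' ρ' ρB' g' h' hB' w' => ?_⟩
  obtain ⟨i, hi⟩ := h.exists_iso h'
  obtain ⟨j, hj⟩ := hB.exists_iso hB'
  refine hg.of_iso (Iso.refl _) i (Iso.refl _) j (by simp [hi]) (by simp)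
    (h.hom_ext hB'.1 ?_) (by simp [hj])
  simp [reassoc_of% hi, w', reassoc_of% w, hj]

end IsReflection

lemma IsCoreflection.hom_ext {T : ObjectProperty C} {A A' : C} {σ : A' ⟶ A}
    (h : IsCoreflection T σ) {X : C} (hX : T X) {s t : X ⟶ A'} (hst : s ≫ σ = t ≫ σ) : s = t :=
  (h.2 hX (t ≫ σ)).unique hst rfl

end General

section Pointed

variable {C : Type u} [Category.{v} C] [HasZeroMorphisms C]

/-! ### Kernels and cokernels -/

lemma IsKernelOf.exists_lift {A B D W : C} {k : A ⟶ B} {q : B ⟶ D} (h : IsKernelOf k q)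
    {g : W ⟶ B} (hg : g ≫ q = 0) : ∃ t : W ⟶ A, t ≫ k = g := by
  obtain ⟨w, ⟨hl⟩⟩ := h
  exact ⟨_, (KernelFork.IsLimit.lift' hl g hg).2⟩

lemma IsKernelOf.mono {A B D : C} {k : A ⟶ B} {q : B ⟶ D} (h : IsKernelOf k q) : Mono k := by
  obtain ⟨w, ⟨hl⟩⟩ := h
  exact ⟨fun s t hst => Fork.IsLimit.hom_ext hl hst⟩

lemma IsKernelOf.of_exists_lift {A B D : C} {k : A ⟶ B} [Mono k] {q : B ⟶ D} (w : k ≫ q = 0)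
    (hl : ∀ ⦃W : C⦄ (g : W ⟶ B), g ≫ q = 0 → ∃ t : W ⟶ A, t ≫ k = g) : IsKernelOf k q := by
  choose l hl using hl
  exact ⟨w, ⟨KernelFork.IsLimit.ofι _ _ (fun g hg => l g hg) (fun g hg => hl g hg)
    (fun g hg m hm => by rw [← cancel_mono k, hm, hl])⟩⟩

lemma IsCokernelOf.exists_desc {A B D W : C} {k : A ⟶ B} {q : B ⟶ D} (h : IsCokernelOf k q)
    {g : B ⟶ W} (hg : k ≫ g = 0) : ∃ t : D ⟶ W, q ≫ t = g := by
  obtain ⟨w, ⟨hl⟩⟩ := h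
  exact ⟨_, (CokernelCofork.IsColimit.desc' hl g hg).2⟩

lemma IsCokernelOf.epi {A B D : C} {k : A ⟶ B} {q : B ⟶ D} (h : IsCokernelOf k q) : Epi q := by
  obtain ⟨w, ⟨hl⟩⟩ := h
  exact ⟨fun s t hst => Cofork.IsColimit.hom_ext hl hst⟩

lemma IsCokernelOf.of_exists_desc {A B D : C} {k : A ⟶ B} {q : B ⟶ D} [Epi q] (w : k ≫ q = 0)
    (hl : ∀ ⦃W : C⦄ (g : B ⟶ W), k ≫ g = 0 → ∃ t : D ⟶ W, q ≫ t = g) : IsCokernelOf k q := by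
  choose l hl using hl
  exact ⟨w, ⟨CokernelCofork.IsColimit.ofπ _ _ (fun g hg => l g hg) (fun g hg => hl g hg)
    (fun g hg m hm => by rw [← cancel_epi q, hm, hl])⟩⟩

lemma IsKernelOf.normalMono {A B D : C} {k : A ⟶ B} {q : B ⟶ D} (h : IsKernelOf k q) :
    normalMonos C k := by
  obtain ⟨w, ⟨hl⟩⟩ := h
  exact ⟨⟨D, q, w, hl⟩⟩

lemma IsCokernelOf.normalEpi {A B D : C} {k : A ⟶ B} {q : B ⟶ D} (h : IsCokernelOf k q) :
    normalEpis C q := by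
  obtain ⟨w, ⟨hl⟩⟩ := h
  exact ⟨⟨A, k, w, hl⟩⟩

lemma exists_isCokernelOf_of_normalEpi {B D : C} {q : B ⟶ D} (h : normalEpis C q) :
    ∃ (A : C) (k : A ⟶ B), IsCokernelOf k q := by
  obtain ⟨⟨A, k, w, hl⟩⟩ := h
  exact ⟨A, k, w, ⟨hl⟩⟩

lemma exists_isKernelOf_of_normalMono {A B : C} {k : A ⟶ B} (h : normalMonos C k) :
    ∃ (D : C) (q : B ⟶ D), IsKernelOf k q := by
  obtain ⟨⟨D, q, w, hl⟩⟩ := h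
  exact ⟨D, q, w, ⟨hl⟩⟩

/-- A normal epimorphism is the cokernel of its kernel. -/
lemma IsKernelOf.isCokernelOf {A B D : C} {k : A ⟶ B} {q : B ⟶ D} (hk : IsKernelOf k q)
    (hq : normalEpis C q) : IsCokernelOf k q := by
  obtain ⟨A', k', h⟩ := exists_isCokernelOf_of_normalEpi hq
  obtain ⟨t, rfl⟩ := hk.exists_lift h.1
  have := h.epi
  exact .of_exists_desc hk.1 fun W g hg => h.exists_desc (by simp [hg])

/-- A normal monomorphism is the kernel of its cokernel. -/
lemma IsCokernelOf.isKernelOf {A B D : C} {k : A ⟶ B} {q : B ⟶ D} (hq : IsCokernelOf k q)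
    (hk : normalMonos C k) : IsKernelOf k q := by
  obtain ⟨A', k', h⟩ := exists_isKernelOf_of_normalMono hk
  obtain ⟨t, rfl⟩ := hq.exists_desc h.1
  have := h.mono
  exact .of_exists_lift hq.1 fun W g hg => h.exists_lift (by simp [reassoc_of% hg])

lemma exists_isKernelOf [HasFiniteLimits C] {B D : C} (q : B ⟶ D) :
    ∃ (A : C) (k : A ⟶ B), IsKernelOf k q :=
  ⟨kernel q, kernel.ι q, .of_exists_lift (kernel.condition q)
    fun _ g hg => ⟨kernel.lift q g hg, by simp⟩⟩

lemma exists_isCokernelOf {A B : C} (k : A ⟶ B) [HasCokernel k] :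
    ∃ (D : C) (q : B ⟶ D), IsCokernelOf k q :=
  ⟨cokernel k, cokernel.π k, .of_exists_desc (cokernel.condition k)
    fun _ g hg => ⟨cokernel.desc k g hg, by simp⟩⟩

lemma IsKernelOf.isPullback [HasZeroObject C] {A B D : C} {k : A ⟶ B} {q : B ⟶ D}
    (h : IsKernelOf k q) : IsPullback k (0 : A ⟶ 0) q (0 : (0 : C) ⟶ D) := by
  have := h.mono
  refine ⟨⟨by simp [h.1]⟩, ⟨PullbackCone.IsLimit.mk _
    (fun s => (h.exists_lift (g := s.fst) (by simp [s.condition])).choose)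
    (fun s => (h.exists_lift (g := s.fst) (by simp [s.condition])).choose_spec)
    (fun s => (isZero_zero C).eq_of_tgt _ _) (fun s m hm _ => ?_)⟩⟩
  rw [← cancel_mono k, hm]
  exact (h.exists_lift (g := s.fst) (by simp [s.condition])).choose_spec.symm

/-- The kernel of a morphism also is the kernel of any of its pullbacks. -/
lemma IsKernelOf.exists_of_isPullback {A P X Y Z : C} {k : A ⟶ Y} {p : P ⟶ X} {t : P ⟶ Y}
    {s : X ⟶ Z} {q : Y ⟶ Z} (h : IsKernelOf k q) (sq : IsPullback p t s q) :
    ∃ k' : A ⟶ P, IsKernelOf k' p := by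
  have := h.mono
  obtain ⟨k', h₀, rfl⟩ := sq.exists_lift 0 k (by simp [h.1])
  have : Mono k' := mono_of_mono k' t
  refine ⟨k', .of_exists_lift h₀ fun W g hg => ?_⟩
  obtain ⟨l, hl⟩ := h.exists_lift (g := g ≫ t) (by simp [← sq.w, reassoc_of% hg])
  exact ⟨l, sq.hom_ext (by simp [hg, h₀]) (by simp [hl])⟩

/-! ### Homological categories -/

variable [HasZeroObject C]

/-- In a homological category every regular epimorphism `p` is the cokernel of its kernel `k`. By
protomodularity the diagonal and `k` jointly generate the kernel pair of `p`, so a morphism that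
annihilates `k` coequalizes the kernel pair. -/
lemma IsHomological.normalEpi_of_isRegularEpi (hC : IsHomological C) {A B : C} (p : A ⟶ B)
    [hp : IsRegularEpi p] : normalEpis C p := by
  have := hC.regular
  obtain ⟨K, k, hk⟩ := exists_isKernelOf p
  have : Epi p := hp.getStruct.epi
  refine IsCokernelOf.normalEpi (.of_exists_desc hk.1 fun D f hf => ?_ : IsCokernelOf k p)
  let π₁ := pullback.fst p p
  let π₂ := pullback.snd p p
  let m := equalizer.ι (π₁ ≫ f) (π₂ ≫ f)
  let k' : K ⟶ pullback p p := pullback.lift 0 k (by simp [hk.1])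
  have hk₁ : k' ≫ π₁ = 0 := pullback.lift_fst _ _ _
  have hk₂ : k' ≫ π₂ = k := pullback.lift_snd _ _ _
  let l : K ⟶ equalizer (π₁ ≫ f) (π₂ ≫ f) :=
    equalizer.lift k' (by simp [reassoc_of% hk₁, reassoc_of% hk₂, hf])
  have hl : l ≫ m = k' := equalizer.lift_ι _ _
  let δ : A ⟶ pullback p p := pullback.lift (𝟙 A) (𝟙 A) rfl
  have hδ₁ : δ ≫ π₁ = 𝟙 A := pullback.lift_fst _ _ _
  have hδ₂ : δ ≫ π₂ = 𝟙 A := pullback.lift_snd _ _ _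
  let d : A ⟶ equalizer (π₁ ≫ f) (π₂ ≫ f) :=
    equalizer.lift δ (by simp [reassoc_of% hδ₁, reassoc_of% hδ₂])
  have hd : d ≫ m = δ := equalizer.lift_ι _ _
  have : IsSplitEpi (m ≫ π₁) := ⟨⟨⟨d, by rw [reassoc_of% hd, hδ₁]⟩⟩⟩
  have := hk.mono
  have : Mono k' := by
    have : Mono (k' ≫ π₂) := by rwa [hk₂]
    exact mono_of_mono k' π₂
  have hk' : IsKernelOf k' π₁ := by
    refine .of_exists_lift hk₁ fun W g hg => ?_
    obtain ⟨t, ht⟩ := hk.exists_lift (g := g ≫ π₂)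
      (by simp only [π₁, π₂, Category.assoc] at hg ⊢
          rw [← pullback.condition, reassoc_of% hg, zero_comp])
    refine ⟨t, pullback.hom_ext ?_ ?_⟩
    · exact (Category.assoc _ _ _).trans (by rw [hk₁, comp_zero]; exact hg.symm)
    · exact (Category.assoc _ _ _).trans (by rw [hk₂, ht])
  have : Mono l := by
    have : Mono (l ≫ m) := by rwa [hl]
    exact mono_of_mono l m
  have hl' : IsKernelOf l (m ≫ π₁) := by
    refine .of_exists_lift (by rw [reassoc_of% hl, hk₁]) fun W g hg => ?_
    obtain ⟨t, ht⟩ := hk'.exists_lift (g := g ≫ m) (by simpa using hg)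
    exact ⟨t, by rw [← cancel_mono m, Category.assoc, hl, ht]⟩
  -- `k'` is the kernel both of `π₁` and of its restriction along `m`, so `m` is invertible.
  have sq := hC.protomodular l m (0 : (0 : C) ⟶ A) (𝟙 A) (0 : K ⟶ 0) (m ≫ π₁) π₁
    ⟨⟨.ofSplitEpi _⟩⟩ (by simp) hl'.isPullback (by simpa [hl] using hk'.isPullback)
  have := sq.isIso_fst_of_isIso
  have hf' : π₁ ≫ f = π₂ ≫ f := by
    rw [← cancel_epi m]
    exact equalizer.condition _ _
  refine ⟨IsRegularEpi.desc p f ?_, IsRegularEpi.fac p f _⟩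
  have e₁ := pullback.lift_fst (f := p) (g := p) _ _ (IsRegularEpi.w p)
  have e₂ := pullback.lift_snd (f := p) (g := p) _ _ (IsRegularEpi.w p)
  calc IsRegularEpi.left p ≫ f
      = pullback.lift _ _ (IsRegularEpi.w p) ≫ π₁ ≫ f := by rw [reassoc_of% e₁]
    _ = pullback.lift _ _ (IsRegularEpi.w p) ≫ π₂ ≫ f := by rw [hf']
    _ = IsRegularEpi.right p ≫ f := by rw [reassoc_of% e₂]

omit [HasZeroObject C] in
lemma isRegularEpi_of_normalEpi {A B : C} {p : A ⟶ B} (hp : normalEpis C p) :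
    IsRegularEpi p :=
  ⟨⟨hp.some.regularEpi⟩⟩

lemma IsHomological.normalEpis_isStableUnderBaseChange (hC : IsHomological C) :
    (normalEpis C).IsStableUnderBaseChange where
  of_isPullback sq hg := by
    have := hC.regular.regularEpiIsStableUnderBaseChange.of_isPullback sq
      (isRegularEpi_of_normalEpi hg)
    exact hC.normalEpi_of_isRegularEpi (hp := this) _

lemma IsHomological.exists_normalEpi_mono_factorization (hC : IsHomological C) {A B : C}
    (f : A ⟶ B) : ∃ (I : C) (e : A ⟶ I) (m : I ⟶ B), normalEpis C e ∧ Mono m ∧ e ≫ m = f := by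
  have := hC.regular
  let φ := Regular.strongEpiMonoFactorisation f
  exact ⟨φ.I, φ.e, φ.m, hC.normalEpi_of_isRegularEpi _, φ.m_mono, φ.fac⟩

lemma IsHomological.exists_epi_normalMono_factorization (hC : IsHomological Cᵒᵖ) {A B : C}
    (f : A ⟶ B) : ∃ (I : C) (e : A ⟶ I) (m : I ⟶ B), Epi e ∧ normalMonos C m ∧ e ≫ m = f := by
  obtain ⟨I, e, m, he, hm, w⟩ := hC.exists_normalEpi_mono_factorization f.op
  obtain ⟨D, k, hk⟩ := exists_isCokernelOf_of_normalEpi he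
  have := hk.epi
  refine ⟨I.unop, m.unop, e.unop, inferInstance, IsKernelOf.normalMono (q := k.unop)
    (.of_exists_lift (by rw [← unop_comp, hk.1, unop_zero]) fun W g hg => ?_), ?_⟩
  · obtain ⟨t, ht⟩ := hk.exists_desc (g := g.op)
      (by rw [← Quiver.Hom.op_unop k, ← op_comp, hg, op_zero])
    exact ⟨t.unop, by rw [← unop_comp, ht, Quiver.Hom.unop_op]⟩
  · rw [← unop_comp, w, Quiver.Hom.unop_op]

end Pointed

end TorsionFactorization

namespace TorsionFactorization

variable {C : Type u} [Category.{v} C] [HasZeroMorphisms C]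

/-! ### Standard torsion theories -/

lemma IsCokernelOf.isReflection {T F : ObjectProperty C}
    (h : ∀ ⦃A B : C⦄, T A → F B → ∀ f : A ⟶ B, f = 0) {A X B : C} {k : A ⟶ X} {q : X ⟶ B}
    (hq : IsCokernelOf k q) (hA : T A) (hB : F B) : IsReflection F q := by
  have := hq.epi
  refine ⟨hB, fun Y hY g => ?_⟩
  obtain ⟨t, ht⟩ := hq.exists_desc (h hA hY (k ≫ g))
  exact ⟨t, ht, fun s hs => by rw [← cancel_epi q, hs, ht]⟩

lemma IsKernelOf.isCoreflection {T F : ObjectProperty C}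
    (h : ∀ ⦃A B : C⦄, T A → F B → ∀ f : A ⟶ B, f = 0) {A X B : C} {k : A ⟶ X} {q : X ⟶ B}
    (hk : IsKernelOf k q) (hA : T A) (hB : F B) : IsCoreflection T k := by
  have := hk.mono
  refine ⟨hA, fun Y hY g => ?_⟩
  obtain ⟨t, ht⟩ := hk.exists_lift (h hY hB (g ≫ q))
  exact ⟨t, ht, fun s hs => by rw [← cancel_mono k, hs, ht]⟩

namespace IsStandardTorsionTheory

variable {T F : ObjectProperty C} (h : IsStandardTorsionTheory T F)
include h

lemma exists_isReflection (X : C) : ∃ (B : C) (q : X ⟶ B), IsReflection F q := by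
  obtain ⟨A, B, k, q, hA, hB, -, hq⟩ := h.exists_sequence X
  exact ⟨B, q, hq.isReflection h.hom_eq_zero hA hB⟩

/-- Every reflection onto the torsion-free part, not only a chosen one, belongs to a short exact
sequence with torsion kernel. -/
lemma exists_kernel_of_isReflection {X B : C} {ρ : X ⟶ B} (hρ : IsReflection F ρ) :
    ∃ (A : C) (k : A ⟶ X), T A ∧ IsKernelOf k ρ ∧ IsCokernelOf k ρ := by
  obtain ⟨A, B', k, q, hA, hB, hk, hq⟩ := h.exists_sequence X
  obtain ⟨i, rfl⟩ := (hq.isReflection h.hom_eq_zero hA hB).exists_iso hρ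
  have := hk.mono
  have := hq.epi
  refine ⟨A, k, hA, .of_exists_lift (by simp [reassoc_of% hk.1]) fun W g hg => ?_,
    .of_exists_desc (by simp [reassoc_of% hq.1]) fun W g hg => ?_⟩
  · exact hk.exists_lift (by rw [← cancel_mono i.hom]; simpa using hg)
  · obtain ⟨t, ht⟩ := hq.exists_desc hg
    exact ⟨i.inv ≫ t, by simp [ht]⟩

lemma torsionFree_of_isZero {Z : C} (hZ : IsZero Z) : F Z := by
  obtain ⟨A, B, k, q, hA, hB, -, hq⟩ := h.exists_sequence Z
  have := hq.epi
  have := h.replete_torsionFree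
  have : q = 0 := hZ.eq_of_src _ _
  exact F.prop_of_iso ((IsZero.of_epi_eq_zero q this).iso hZ) hB

lemma isReflection_zero [HasZeroObject C] : IsReflection F (𝟙 (0 : C)) :=
  ⟨h.torsionFree_of_isZero (isZero_zero C), fun _ _ g =>
    ⟨g, Category.id_comp g, fun s _ => (isZero_zero C).eq_of_src s g⟩⟩

lemma torsion_iff_isZero {X B : C} {ρ : X ⟶ B} (hρ : IsReflection F ρ) : T X ↔ IsZero B := by
  obtain ⟨A, k, hA, hk, hq⟩ := h.exists_kernel_of_isReflection hρ
  have := hq.epi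
  have := hk.mono
  refine ⟨fun hX => IsZero.of_epi_eq_zero ρ (h.hom_eq_zero hX hρ.1 ρ), fun hB => ?_⟩
  obtain ⟨t, ht⟩ := hk.exists_lift (g := 𝟙 X) (hB.eq_of_tgt _ _)
  have := h.replete_torsion
  exact T.prop_of_iso ⟨k, t, by rw [← cancel_mono k]; simp [ht], ht⟩ hA

lemma torsionFree_iff_isIso {X B : C} {ρ : X ⟶ B} (hρ : IsReflection F ρ) : F X ↔ IsIso ρ := by
  refine ⟨fun hX => ?_, fun hi => ?_⟩
  · obtain ⟨t, ht⟩ := hρ.exists_desc hX (𝟙 X)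
    exact ⟨t, ht, hρ.hom_ext hρ.1 (by simp [reassoc_of% ht])⟩
  · have := h.replete_torsionFree
    exact F.prop_of_iso (asIso ρ).symm hρ.1

lemma invertedByReflector_comp {X Y Z : C} {f : X ⟶ Y} {g : Y ⟶ Z}
    (hg : invertedByReflector F g) :
    invertedByReflector F (f ≫ g) ↔ invertedByReflector F f := by
  obtain ⟨X', ρX, hX⟩ := h.exists_isReflection X
  obtain ⟨Y', ρY, hY⟩ := h.exists_isReflection Y
  obtain ⟨Z', ρZ, hZ⟩ := h.exists_isReflection Z
  obtain ⟨f', hf'⟩ := hX.exists_desc hY.1 (f ≫ ρY)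
  obtain ⟨g', hg'⟩ := hY.exists_desc hZ.1 (g ≫ ρZ)
  have : IsIso g' := hg _ _ _ hY hZ hg'
  rw [hX.invertedByReflector_iff hY hf', hX.invertedByReflector_iff (g := f' ≫ g') hZ
    (by simp [reassoc_of% hf', hg'])]
  exact ⟨fun _ => IsIso.of_isIso_comp_right f' g', fun _ => inferInstance⟩

lemma invertedByReflector_of_isIso {X Y : C} (f : X ⟶ Y) [IsIso f] :
    invertedByReflector F f := by
  obtain ⟨X', ρX, hX⟩ := h.exists_isReflection X
  obtain ⟨Y', ρY, hY⟩ := h.exists_isReflection Y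
  obtain ⟨f', hf'⟩ := hX.exists_desc hY.1 (f ≫ ρY)
  obtain ⟨g', hg'⟩ := hY.exists_desc hX.1 (inv f ≫ ρX)
  rw [hX.invertedByReflector_iff hY hf']
  exact ⟨g', hX.hom_ext hX.1 (by simp [reassoc_of% hf', hg']),
    hY.hom_ext hY.1 (by simp [reassoc_of% hg', hf'])⟩

/-- `R⁻¹(Iso) ⊥ Cart(R, ρ)`: a diagonal into a pullback along `ρY` is determined by its component
in the torsion-free part, and that component extends along the inverted morphism. -/
lemma orth {A B X Y : C} {e : A ⟶ B} {m : X ⟶ Y} (he : invertedByReflector F e)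
    (hm : cartesianForReflector F m) : Orth e m := by
  intro a b w
  obtain ⟨A', ρA, hA⟩ := h.exists_isReflection A
  obtain ⟨B', ρB, hB⟩ := h.exists_isReflection B
  obtain ⟨X', ρX, hX⟩ := h.exists_isReflection X
  obtain ⟨Y', ρY, hY⟩ := h.exists_isReflection Y
  obtain ⟨e', he'⟩ := hA.exists_desc hB.1 (e ≫ ρB)
  obtain ⟨m', hm'⟩ := hX.exists_desc hY.1 (m ≫ ρY)
  obtain ⟨a', ha'⟩ := hA.exists_desc hX.1 (a ≫ ρX)
  obtain ⟨b', hb'⟩ := hB.exists_desc hY.1 (b ≫ ρY)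
  have : IsIso e' := he _ _ _ hA hB he'
  have sq := hm _ _ _ hX hY hm'
  have key : a' ≫ m' = e' ≫ b' := hA.hom_ext hY.1 (by
    rw [reassoc_of% ha', hm', reassoc_of% he', hb', reassoc_of% w])
  have wd : (ρB ≫ inv e' ≫ a') ≫ m' = b ≫ ρY := by simp [key, hb']
  refine ⟨sq.lift (ρB ≫ inv e' ≫ a') b wd, ⟨sq.hom_ext ?_ (by simp [w]), by simp⟩, ?_⟩
  · simp [← reassoc_of% he', ha']
  · rintro d ⟨rfl, rfl⟩
    refine sq.hom_ext ?_ (by simp)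
    obtain ⟨d', hd'⟩ := hB.exists_desc hX.1 (d ≫ ρX)
    obtain rfl : e' ≫ d' = a' := hA.hom_ext hX.1 (by
      rw [reassoc_of% he', hd', ha', Category.assoc])
    simp [hd']

/-- The pullback of `ρ_B` along `R f` is again a normal epimorphism with torsion kernel, hence a
reflection; so the comparison into the pullback is inverted by the reflector. -/
lemma exists_factorization [HasFiniteLimits C]
    (hs : (normalEpis C).IsStableUnderBaseChange) {A B : C} (f : A ⟶ B) :
    ∃ (Z : C) (e : A ⟶ Z) (m : Z ⟶ B),
      invertedByReflector F e ∧ cartesianForReflector F m ∧ e ≫ m = f := by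
  obtain ⟨A', ρA, hA⟩ := h.exists_isReflection A
  obtain ⟨B', ρB, hB⟩ := h.exists_isReflection B
  obtain ⟨f', hf'⟩ := hA.exists_desc hB.1 (f ≫ ρB)
  have sq := IsPullback.of_hasPullback f' ρB
  obtain ⟨K, k, hK, hk, hq⟩ := h.exists_kernel_of_isReflection hB
  obtain ⟨k', hk'⟩ := hk.exists_of_isPullback sq
  have hp := (hk'.isCokernelOf (hs.of_isPullback sq.flip hq.normalEpi)).isReflection
    h.hom_eq_zero hK hA.1
  refine ⟨_, sq.lift ρA f hf', _, ?_, (hp.cartesianForReflector_iff hB sq.w).2 sq, by simp⟩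
  rw [hA.invertedByReflector_iff (g := 𝟙 _) hp (by simp)]
  infer_instance

lemma isReflectiveFS [HasFiniteLimits C] (hs : (normalEpis C).IsStableUnderBaseChange) :
    IsReflectiveFS (invertedByReflector F) (cartesianForReflector F) where
  toIsFactorizationSystem := by
    refine .of_orth (fun A B f => h.exists_factorization hs f) (fun A B X Y e m => h.orth)
      (fun A B D e i hi he => ?_) (fun A B D i m hi hm => ?_)
    · exact (h.invertedByReflector_comp (h.invertedByReflector_of_isIso i)).2 he
    · obtain ⟨A', ρA, hA⟩ := h.exists_isReflection A
      obtain ⟨B', ρB, hB⟩ := h.exists_isReflection B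
      obtain ⟨D', ρD, hD⟩ := h.exists_isReflection D
      obtain ⟨i', hi'⟩ := hA.exists_desc hB.1 (i ≫ ρB)
      obtain ⟨m', hm'⟩ := hB.exists_desc hD.1 (m ≫ ρD)
      have : IsIso i' := h.invertedByReflector_of_isIso i _ _ _ hA hB hi'
      refine (hA.cartesianForReflector_iff hD (g := i' ≫ m')
        (by simp [reassoc_of% hi', hm'])).2 ?_
      exact (IsPullback.of_vert_isIso ⟨hi'⟩).paste_vert (hm _ _ _ hB hD hm')
  cancel_left X Y Z f g hfg hg := (h.invertedByReflector_comp hg).1 hfg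

variable [HasZeroObject C]

lemma torsionFreePart_eq : torsionFreePart (cartesianForReflector F) = F := by
  funext B
  obtain ⟨B', ρ, hB⟩ := h.exists_isReflection B
  refine propext ?_
  rw [h.torsionFree_iff_isIso hB]
  refine (hB.cartesianForReflector_iff (g := 0) h.isReflection_zero (by simp)).trans
    ⟨fun sq => sq.isIso_fst_of_isIso, fun _ => .of_horiz_isIso ⟨by simp⟩⟩

lemma torsionPart_eq : torsionPart (invertedByReflector F) = T := by
  funext A
  obtain ⟨A', ρ, hA⟩ := h.exists_isReflection A
  refine propext ?_
  rw [h.torsion_iff_isZero hA]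
  refine (h.isReflection_zero.invertedByReflector_iff (g := 0) hA (by simp)).trans
    ⟨fun _ => (isZero_zero C).of_iso (asIso (0 : (0 : C) ⟶ A')).symm,
      fun hz => ⟨0, (isZero_zero C).eq_of_src _ _, hz.eq_of_src _ _⟩⟩

omit [HasZeroObject C] in
lemma isNormalEpireflective : IsNormalEpireflective F := fun X => by
  obtain ⟨A, B, k, q, hA, hB, hk, hq⟩ := h.exists_sequence X
  exact ⟨B, q, hq.isReflection h.hom_eq_zero hA hB, hq.normalEpi⟩

omit [HasZeroObject C] in
lemma isNormalMonocoreflective : IsNormalMonocoreflective T := fun X => by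
  obtain ⟨A, B, k, q, hA, hB, hk, hq⟩ := h.exists_sequence X
  exact ⟨A, k, hk.isCoreflection h.hom_eq_zero hA hB, hk.normalMono⟩

lemma isSimpleReflectiveFS [HasFiniteLimits C] (hs : (normalEpis C).IsStableUnderBaseChange) :
    IsSimpleReflectiveFS (invertedByReflector F) (cartesianForReflector F) where
  toIsReflectiveFS := h.isReflectiveFS hs
  eq_cartesian := by rw [h.torsionFreePart_eq]

end IsStandardTorsionTheory

variable [HasZeroObject C]

/-! ### Torsion and torsion-free objects of a factorization system -/

namespace IsFactorizationSystem

variable {E M : MorphismProperty C} (h : IsFactorizationSystem E M)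
include h

/-- The reflection of `X` onto `F(M)` is obtained by factoring `X ⟶ 0`. -/
lemma exists_isReflection (X : C) :
    ∃ (X' : C) (ρ : X ⟶ X'), E ρ ∧ IsReflection (torsionFreePart M) ρ := by
  obtain ⟨X', ρ, m, hρ, hm, -⟩ := h.factors (0 : X ⟶ (0 : C))
  obtain rfl : m = 0 := (isZero_zero C).eq_of_tgt _ _
  refine ⟨X', ρ, hρ, hm, fun Y hY g => ?_⟩
  obtain ⟨d, ⟨hd₁, -⟩, hd⟩ := h.orth hρ hY g 0 (by simp)
  exact ⟨d, hd₁, fun d' h' => hd d' ⟨h', by simp⟩⟩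

/-- The coreflection of `X` from `T(E)` is obtained by factoring `0 ⟶ X`. -/
lemma exists_isCoreflection (X : C) :
    ∃ (X' : C) (σ : X' ⟶ X), M σ ∧ IsCoreflection (torsionPart E) σ := by
  obtain ⟨X', e, σ, he, hσ, -⟩ := h.factors (0 : (0 : C) ⟶ X)
  obtain rfl : e = 0 := (isZero_zero C).eq_of_src _ _
  refine ⟨X', σ, hσ, he, fun Y hY g => ?_⟩
  obtain ⟨d, ⟨-, hd₂⟩, hd⟩ := h.orth hY hσ 0 g (by simp)
  exact ⟨d, hd₂, fun d' h' => hd d' ⟨by simp, h'⟩⟩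

lemma hom_eq_zero {A B : C} (hA : torsionPart E A) (hB : torsionFreePart M B) (f : A ⟶ B) :
    f = 0 :=
  (h.orth hA hB 0 0 (by simp)).unique ⟨by simp, by simp⟩ ⟨by simp, by simp⟩

lemma isClosedUnderIsomorphisms_torsionPart : (torsionPart E).IsClosedUnderIsomorphisms where
  of_iso i hX := by
    have := h.left_comp hX (h.left_of_isIso i.hom)
    rwa [zero_comp] at this

lemma isClosedUnderIsomorphisms_torsionFreePart :
    (torsionFreePart M).IsClosedUnderIsomorphisms where
  of_iso {X Y} i hX := h.right_of_isPullback
    (.of_vert_isIso ⟨by simp⟩ : IsPullback (0 : Y ⟶ 0) i.inv (𝟙 _) (0 : X ⟶ 0)) hX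

/-- Every morphism between objects of `F(M)` lies in `M`. -/
lemma right_of_torsionFree {X Y : C} (hX : torsionFreePart M X) (hY : torsionFreePart M Y)
    (f : X ⟶ Y) : M f := by
  refine h.right_of_comp (g := (0 : Y ⟶ 0)) ?_ hY
  rwa [comp_zero]

end IsFactorizationSystem

/-- In a reflective factorization system `E` is determined by `F(M)`. -/
lemma IsReflectiveFS.left_eq_invertedByReflector {E M : MorphismProperty C}
    (h : IsReflectiveFS E M) : E = invertedByReflector (torsionFreePart M) := by
  funext X Y f
  obtain ⟨X', ρX, hEX, hX⟩ := h.exists_isReflection X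
  obtain ⟨Y', ρY, hEY, hY⟩ := h.exists_isReflection Y
  obtain ⟨f', hf'⟩ := hX.exists_desc hY.1 (f ≫ ρY)
  refine propext ?_
  rw [hX.invertedByReflector_iff hY hf']
  refine ⟨fun hf => ?_, fun _ => h.cancel_left f ρY ?_ hEY⟩
  · exact h.isIso_of_left_of_right (h.left_of_comp (hf' ▸ h.left_comp hf hEY) hEX)
      (h.right_of_torsionFree hX.1 hY.1 f')
  · rw [← hf']
    exact h.left_comp hEX (h.left_of_isIso f')

/-! ### Simple reflective factorization systems in homological categories -/

/-- Kernels of reflections are torsion. The kernel `κ` of `ρ` is a pullback of the zero morphism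
into `X'`, so it lies in `M` and its naturality square is a pullback. As the reflector sends `κ`
to zero, the identity of the reflection of `K` then factors through a zero morphism into `K`. -/
lemma IsSimpleReflectiveFS.torsionPart_of_isKernelOf {E M : MorphismProperty C}
    (h : IsSimpleReflectiveFS E M) {K X X' : C} {κ : K ⟶ X} {ρ : X ⟶ X'}
    (hρ : IsReflection (torsionFreePart M) ρ) (hκ : IsKernelOf κ ρ) : torsionPart E K := by
  have : Mono κ := hκ.mono
  have hM : M κ := h.right_of_isPullback hκ.isPullback
    (h.right_of_torsionFree (h.right_of_isIso _) hρ.1 _)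
  obtain ⟨K', ρK, hE, hK⟩ := h.exists_isReflection K
  rw [h.eq_cartesian] at hM
  have sq := hM ρK ρ 0 hK hρ (by simp [hκ.1])
  have hl : sq.lift (𝟙 K') 0 (by simp) = 0 := by rw [← cancel_mono κ]; simp
  have hK' : IsZero K' := by
    rw [IsZero.iff_id_eq_zero, ← sq.lift_fst (𝟙 K') 0 (by simp), hl, zero_comp]
  have : IsIso ((0 : (0 : C) ⟶ K) ≫ ρK) :=
    ⟨0, (isZero_zero C).eq_of_src _ _, hK'.eq_of_src _ _⟩
  exact h.cancel_left _ ρK (h.left_of_isIso _) hE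

/-- For `f` and `f ≫ g` in `M`, protomodularity applies to the naturality squares of `f` and `g`,
whose common vertical arrow is a reflection and hence a regular epimorphism. -/
lemma IsSimpleReflectiveFS.isCoreflectiveFS {E M : MorphismProperty C}
    (hC : IsHomological C) (h : IsSimpleReflectiveFS E M)
    (hF : IsNormalEpireflective (torsionFreePart M)) : IsCoreflectiveFS E M where
  toIsFactorizationSystem := h.toIsFactorizationSystem
  cancel_right X Y Z f g hfg hf := by
    obtain ⟨X', ρX, hX, -⟩ := hF X
    obtain ⟨Y', ρY, hY, hYn⟩ := hF Y
    obtain ⟨Z', ρZ, hZ, -⟩ := hF Z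
    obtain ⟨f', hf'⟩ := hX.exists_desc hY.1 (f ≫ ρY)
    obtain ⟨g', hg'⟩ := hY.exists_desc hZ.1 (g ≫ ρZ)
    rw [h.eq_cartesian] at hf hfg ⊢
    have sq₁ := hf _ _ _ hX hY hf'
    have sq₂ := hfg _ _ (f' ≫ g') hX hZ (by simp [reassoc_of% hf', hg'])
    exact (hY.cartesianForReflector_iff hZ hg').2
      (hC.protomodular f g f' g' ρX ρY ρZ (isRegularEpi_of_normalEpi hYn) hg'.symm
        sq₁.flip sq₂.flip).flip

lemma IsSimpleReflectiveFS.isNormalTorsionTheory [HasFiniteLimits C]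
    (hcoker : ∀ ⦃X Y : C⦄ (k : X ⟶ Y), normalMonos C k → HasCokernel k)
    (hC : IsHomological C) {E M : MorphismProperty C} (h : IsSimpleReflectiveFS E M)
    (hF : IsNormalEpireflective (torsionFreePart M))
    (hT : IsNormalMonocoreflective (torsionPart E)) : IsNormalTorsionTheory E M where
  reflective := h.toIsReflectiveFS
  coreflective := h.isCoreflectiveFS hC hF
  kernel_comp_cokernel X := by
    obtain ⟨RX, ρ, hρ, -⟩ := hF X
    obtain ⟨SX, σ, hσ, hσn⟩ := hT X
    obtain ⟨K, κ, hκ⟩ := exists_isKernelOf ρ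
    have := hcoker σ hσn
    obtain ⟨Q, π, hπ⟩ := exists_isCokernelOf σ
    refine ⟨SX, RX, K, Q, σ, ρ, κ, π, hσ, hρ, hκ, hπ, ?_⟩
    obtain ⟨t, rfl⟩ := (hσ.2 (h.torsionPart_of_isKernelOf hρ hκ) κ).exists
    rw [Category.assoc, hπ.1, comp_zero]

/-! ### Normal torsion theories -/

namespace IsTorsionTheory

variable {E M : MorphismProperty C} (h : IsTorsionTheory E M)
include h

/-- `F(M)` is closed under subobjects. If `I` embeds into a torsion-free object, its coreflection
is a zero morphism, hence has zero domain, so `0 ⟶ I` lies in `M`; coreflectivity then puts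
`I ⟶ 0` in `M`. -/
lemma torsionFreePart_of_mono {I Y : C} (m : I ⟶ Y) [Mono m] (hY : torsionFreePart M Y) :
    torsionFreePart M I := by
  have h' := h.reflective.toIsFactorizationSystem
  obtain ⟨S, σ, hM, hσ⟩ := h'.exists_isCoreflection I
  have hσ₀ : σ = 0 := by
    rw [← cancel_mono m, zero_comp]
    exact h'.hom_eq_zero hσ.1 hY _
  have hS : IsZero S := by
    rw [IsZero.iff_id_eq_zero]
    exact hσ.hom_ext hσ.1 (by simp [hσ₀])
  refine h.coreflective.cancel_right σ 0 ?_ hM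
  have : IsIso (σ ≫ (0 : I ⟶ (0 : C))) :=
    ⟨0, hS.eq_of_src _ _, (isZero_zero C).eq_of_src _ _⟩
  exact h'.right_of_isIso _

/-- `T(E)` is closed under quotients, dually to `torsionFreePart_of_mono`. -/
lemma torsionPart_of_epi {I Y : C} (e : Y ⟶ I) [Epi e] (hY : torsionPart E Y) :
    torsionPart E I := by
  have h' := h.reflective.toIsFactorizationSystem
  obtain ⟨R, ρ, hE, hρ⟩ := h'.exists_isReflection I
  have hρ₀ : ρ = 0 := by
    rw [← cancel_epi e, comp_zero]
    exact h'.hom_eq_zero hY hρ.1 _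
  have hR : IsZero R := by
    rw [IsZero.iff_id_eq_zero]
    exact hρ.hom_ext hρ.1 (by simp [hρ₀])
  refine h.reflective.cancel_left 0 ρ ?_ hE
  have : IsIso ((0 : (0 : C) ⟶ I) ≫ ρ) :=
    ⟨0, (isZero_zero C).eq_of_src _ _, hR.eq_of_src _ _⟩
  exact h'.left_of_isIso _

/-- The image of a reflection is torsion-free, so the reflection coincides with its image. -/
lemma normalEpi_of_isReflection (hC : IsHomological C) {X X' : C} {ρ : X ⟶ X'}
    (hρ : IsReflection (torsionFreePart M) ρ) : normalEpis C ρ := by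
  obtain ⟨I, e, m, he, hm, rfl⟩ := hC.exists_normalEpi_mono_factorization ρ
  obtain ⟨A, k, hk⟩ := exists_isCokernelOf_of_normalEpi he
  have := hk.epi
  obtain ⟨t, ht⟩ := hρ.exists_desc (h.torsionFreePart_of_mono m hρ.1) e
  have htm : t ≫ m = 𝟙 _ := hρ.hom_ext hρ.1 (by simp [reassoc_of% ht])
  have : IsSplitEpi m := ⟨⟨⟨t, htm⟩⟩⟩
  have : IsIso m := isIso_of_mono_of_isSplitEpi m
  exact IsCokernelOf.normalEpi (k := k) (.of_exists_desc (by simp [reassoc_of% hk.1])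
    fun W g hg => by
      obtain ⟨s, hs⟩ := hk.exists_desc hg
      exact ⟨inv m ≫ s, by simp [hs]⟩)

/-- Factor a coreflection into an epimorphism and a normal monomorphism. The object in between is a
quotient of a torsion object, hence torsion, so the epimorphism is invertible. -/
lemma normalMono_of_isCoreflection (hC : IsHomological Cᵒᵖ) {X X' : C} {σ : X' ⟶ X}
    (hσ : IsCoreflection (torsionPart E) σ) : normalMonos C σ := by
  obtain ⟨I, e, m, he, hm, rfl⟩ := hC.exists_epi_normalMono_factorization σ
  obtain ⟨D, q, hq⟩ := exists_isKernelOf_of_normalMono hm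
  have := hq.mono
  obtain ⟨t, ht, -⟩ := hσ.2 (h.torsionPart_of_epi e hσ.1) m
  have het : e ≫ t = 𝟙 _ := hσ.hom_ext hσ.1 (by simp [ht])
  have : IsSplitMono e := ⟨⟨⟨t, het⟩⟩⟩
  have : IsIso e := isIso_of_epi_of_isSplitMono e
  exact IsKernelOf.normalMono (q := q) (.of_exists_lift (by simp [hq.1])
    fun W g hg => by
      obtain ⟨s, hs⟩ := hq.exists_lift hg
      exact ⟨s ≫ inv e, by simp [hs]⟩)

end IsTorsionTheory

/-- With `ρ` a normal epimorphism and `σ` a normal monomorphism, normality says exactly that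
`σ = ker (coker σ)` and `ker ρ` are the same subobject. -/
lemma IsNormalTorsionTheory.isStandardTorsionTheory (hC : IsHomological C)
    (hC' : IsHomological Cᵒᵖ) {E M : MorphismProperty C} (h : IsNormalTorsionTheory E M) :
    IsStandardTorsionTheory (torsionPart E) (torsionFreePart M) where
  replete_torsion := h.reflective.isClosedUnderIsomorphisms_torsionPart
  replete_torsionFree := h.reflective.isClosedUnderIsomorphisms_torsionFreePart
  hom_eq_zero _ _ hA hB f := h.reflective.hom_eq_zero hA hB f
  exists_sequence X := by
    obtain ⟨S, R, K, Q, σ, ρ, κ, π, hσ, hρ, hκ, hπ, w⟩ := h.kernel_comp_cokernel X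
    have hσn := h.normalMono_of_isCoreflection hC' hσ
    have hρn := h.normalEpi_of_isReflection hC hρ
    have hσk : IsKernelOf σ ρ := by
      have hσπ := hπ.isKernelOf hσn
      have := hσπ.mono
      obtain ⟨t, rfl⟩ := hσπ.exists_lift w
      refine .of_exists_lift (h.reflective.hom_eq_zero hσ.1 hρ.1 _) fun W g hg => ?_
      obtain ⟨s, hs⟩ := hκ.exists_lift hg
      exact ⟨s ≫ t, by simpa using hs⟩
    exact ⟨S, R, σ, ρ, hσ.1, hρ.1, hσk, hσk.isCokernelOf hρn⟩

end TorsionFactorization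

open TorsionFactorization in
theorem theorem5p2 {C : Type u} [Category.{v} C] [HasFiniteLimits C] [HasZeroObject C]
    [HasZeroMorphisms C]
    (hcoker : ∀ ⦃X Y : C⦄ (k : X ⟶ Y), normalMonos C k → HasCokernel k) :
    ((normalEpis C).IsStableUnderBaseChange →
      ∀ T F : ObjectProperty C, IsStandardTorsionTheory T F →
        IsSimpleReflectiveFS (invertedByReflector F) (cartesianForReflector F) ∧
        torsionFreePart (cartesianForReflector F) = F ∧
        torsionPart (invertedByReflector F) = T ∧
        IsNormalEpireflective (torsionFreePart (cartesianForReflector F)) ∧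
        IsNormalMonocoreflective (torsionPart (invertedByReflector F))) ∧
    (IsHomological C →
      ∀ E M : MorphismProperty C, IsSimpleReflectiveFS E M →
        IsNormalEpireflective (torsionFreePart M) → IsNormalMonocoreflective (torsionPart E) →
        IsNormalTorsionTheory E M) ∧
    (IsHomological C → IsHomological Cᵒᵖ →
      ∃ Φ : {p : MorphismProperty C × MorphismProperty C // IsNormalTorsionTheory p.1 p.2} ≃
          {q : ObjectProperty C × ObjectProperty C // IsStandardTorsionTheory q.1 q.2},
        (∀ p, (Φ p).1 = (torsionPart p.1.1, torsionFreePart p.1.2)) ∧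
        ∀ q, (Φ.symm q).1 = (invertedByReflector q.1.2, cartesianForReflector q.1.2)) := by
  have part₁ (hs : (normalEpis C).IsStableUnderBaseChange) (T F : ObjectProperty C)
      (h : IsStandardTorsionTheory T F) :
      IsSimpleReflectiveFS (invertedByReflector F) (cartesianForReflector F) ∧
        torsionFreePart (cartesianForReflector F) = F ∧
        torsionPart (invertedByReflector F) = T ∧
        IsNormalEpireflective (torsionFreePart (cartesianForReflector F)) ∧
        IsNormalMonocoreflective (torsionPart (invertedByReflector F)) := by
    rw [h.torsionPart_eq, h.torsionFreePart_eq]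
    exact ⟨h.isSimpleReflectiveFS hs, rfl, rfl, h.isNormalEpireflective,
      h.isNormalMonocoreflective⟩
  refine ⟨part₁, fun hC E M h => h.isNormalTorsionTheory hcoker hC, fun hC hC' => ?_⟩
  have hs := hC.normalEpis_isStableUnderBaseChange
  refine ⟨
    { toFun := fun p => ⟨(torsionPart p.1.1, torsionFreePart p.1.2),
        p.2.isStandardTorsionTheory hC hC'⟩
      invFun := fun q => ⟨(invertedByReflector q.1.2, cartesianForReflector q.1.2), by
        obtain ⟨h, -, -, hF, hT⟩ := part₁ hs _ _ q.2
        exact h.isNormalTorsionTheory hcoker hC hF hT⟩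
      left_inv := fun ⟨⟨E, M⟩, h⟩ => ?_
      right_inv := fun ⟨⟨T, F⟩, h⟩ => ?_ }, fun _ => rfl, fun _ => rfl⟩
  · have hE : E = invertedByReflector (torsionFreePart M) :=
      h.reflective.left_eq_invertedByReflector
    -- Both right classes are the right orthogonal of the common left class.
    have hM : M = cartesianForReflector (torsionFreePart M) := by
      rw [((h.isStandardTorsionTheory hC hC').isReflectiveFS hs).right_eq, ← hE]
      exact h.reflective.right_eq
    exact Subtype.ext (Prod.ext hE.symm hM.symm)
  · exact Subtype.ext (Prod.ext h.torsionPart_eq h.torsionFreePart_eq)
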